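/- Let $G$ be a locally compact abelian group (written additively), with Pontryagin dual $\widehat G$, the group of continuous homomorphisms $G\to S^1$, also written additively. Let $u:G\to\mathbb R$ be continuous, strictly positive and positive-definite (for all $x_1,\dots,x_n\in G$ the matrix $(u(x_j-x_i))_{i,j}$ is Hermitian and nonnegative-definite), with $u(0)=1$. Let $G_u$ be the group $G$ with the convolution of point measures $$\delta_x*\delta_y=\frac{u(x)u(y)}{u(x+y)}\,\delta_{x+y}.$$ A symmetric quasi-character of $G_u$ is a function $\varphi:G\to\mathbb C$ with $\varphi(x)\varphi(y)=\int_G\varphi\,d(\delta_x*\delta_y)$ and $\varphi(-x)=\overline{\varphi(x)}$ for all $x,y\in G$. Let $\hat u$ be the Fourier transform of $u$, i.e. the bounded (nonnegative) Radon measure on $\widehat G$ with $u(x)=\int_{\widehat G}\chi(x)\,d\hat u(\chi)$ for all $x\in G$, and let $T_\psi\hat u$ denote the translate of $\hat u$ by $\psi\in\widehat G$, i.e. its image under $\chi\mapsto\psi+\chi$. Then: 1. For every $\chi\in\widehat G$ the function $\chi u$ is a symmetric quasi-character of $G_u$, and every continuous symmetric quasi-character of $G_u$ that is not identically zero equals $\chi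 u$ for exactly one $\chi\in\widehat G$. 2. These functions multiply according to the convolution $\delta_{\chi_1}*\delta_{\chi_2}=T_{\chi_1+\chi_2}\hat u$ on $\widehat G$: for all $\chi_1,\chi_2\in\widehat G$ and $x\in G$, the function $\chi\mapsto\chi(x)u(x)$ is integrable with respect to $T_{\chi_1+\chi_2}\hat u$, and $$(\chi_1(x)u(x))\,(\chi_2(x)u(x))=\int_{\widehat G}\chi(x)u(x)\,d(T_{\chi_1+\chi_2}\hat u)(\chi).$$ -/

import Mathlib

/-!
Ghost-spaces over a locally compact abelian group. The groups are written multiplicatively, as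
Mathlib's `PontryaginDual` is: `x * y`, `x⁻¹`, `1` stand for `x + y`, `-x`, `0`.
-/

namespace GhostSpace

open MeasureTheory
open scoped ComplexOrder

noncomputable section

/-- A complex function `f` on a group is positive-definite if all the matrices
`(f (x_j - x_i))_{i,j}` are Hermitian and nonnegative-definite. -/
def IsPositiveDefinite {G : Type*} [CommGroup G] (f : G → ℂ) : Prop :=
  ∀ (n : ℕ) (x : Fin n → G), (Matrix.of fun i j => f (x j * (x i)⁻¹)).PosSemidef

/-- The functions `u` that define a ghost-space of the first kind `G_u`: strictly positive,
positive-definite, continuous, with value `1` at the neutral element. -/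
structure IsGhostFunction {G : Type*} [CommGroup G] [TopologicalSpace G] (u : G → ℝ) : Prop where
  pos : ∀ x, 0 < u x
  positiveDefinite : IsPositiveDefinite fun x => (u x : ℂ)
  continuous : Continuous u
  map_one : u 1 = 1

/-- The convolution of point measures in `G_u`, namely
`δ_x * δ_y = (u(x) u(y) / u(x+y)) δ_{x+y}`. -/
def firstKindConv {G : Type*} [CommGroup G] [MeasurableSpace G] (u : G → ℝ) (x y : G) :
    Measure G :=
  ENNReal.ofReal (u x * u y / u (x * y)) • Measure.dirac (x * y)

/-- The translate `T_a μ` of a measure. -/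
def translateMeasure {H : Type*} [CommGroup H] [MeasurableSpace H] (a : H) (μ : Measure H) : Measure H :=
  μ.map fun b => a * b

/-- The convolution of point measures in `H^μ`, namely `δ_a * δ_b = T_{a+b} μ`. -/
def secondKindConv {H : Type*} [CommGroup H] [MeasurableSpace H] (μ : Measure H) (a b : H) :
    Measure H :=
  translateMeasure (a * b) μ

/-- A symmetric quasi-character of a convolution structure `(x, y) ↦ δ_x * δ_y` on `G`: a function
with `φ(x) φ(y) = ∫ φ d(δ_x * δ_y)` and `φ(-x) = conj φ(x)`. -/
structure IsSymmQuasiCharacter {G : Type*} [CommGroup G] [MeasurableSpace G]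
    (conv : G → G → Measure G) (φ : G → ℂ) : Prop where
  mul_eq : ∀ x y, φ x * φ y = ∫ z, φ z ∂(conv x y)
  symm : ∀ x, φ x⁻¹ = starRingEnd ℂ (φ x)

/-- The function `φ_χ(x) = χ(x) u(x)` on `G`, for a character `χ`. -/
def quasiChar {G : Type*} [CommGroup G] [TopologicalSpace G] (u : G → ℝ) (χ : PontryaginDual G)
    (x : G) : ℂ :=
  (χ x : ℂ) * (u x : ℂ)

/-- The inverse Fourier transform `x ↦ ∫ χ(x) dμ(χ)` of a measure on the dual group. -/
def inverseFourier {G : Type*} [CommGroup G] [TopologicalSpace G]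
    [MeasurableSpace (PontryaginDual G)] (μ : Measure (PontryaginDual G)) (x : G) : ℂ :=
  ∫ χ, (χ x : ℂ) ∂μ

/-- `μ` is the Fourier transform `û` of `u`: the bounded Radon measure on the dual group whose
inverse Fourier transform is `u`. -/
structure IsFourierTransform {G : Type*} [CommGroup G] [TopologicalSpace G]
    [MeasurableSpace (PontryaginDual G)] (u : G → ℝ) (μ : Measure (PontryaginDual G)) : Prop where
  finite : IsFiniteMeasure μ
  regular : μ.Regular
  inverseFourier_eq : ∀ x, (u x : ℂ) = inverseFourier μ x

end

end GhostSpace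

/-!
Dividing by `u` cancels the weight of the convolution: `ψ u` is a symmetric quasi-character of `G_u`
if and only if `ψ` is multiplicative and turns inversion into conjugation. Such a nonzero `ψ` has
modulus one, so when it is continuous it is a character of `G`. On the dual side, translating a
measure by `ψ` multiplies its inverse Fourier transform by `ψ`, so that
`∫ χ(x) u(x) d(T_ψ û)(χ) = ψ(x) u(x)²`.
-/

namespace GhostSpace

open MeasureTheory ComplexConjugate

variable {G : Type*} [CommGroup G]

section FirstKind

variable [MeasurableSpace G] {u : G → ℝ}

theorem integral_firstKindConv {E : Type*} [NormedAddCommGroup E] [NormedSpace ℝ E]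
    [CompleteSpace E] (hu : ∀ x, 0 ≤ u x) {f : G → E} (hf : StronglyMeasurable f) (x y : G) :
    ∫ z, f z ∂(firstKindConv u x y) = (u x * u y / u (x * y)) • f (x * y) := by
  have hweight : 0 ≤ u x * u y / u (x * y) := div_nonneg (mul_nonneg (hu x) (hu y)) (hu (x * y))
  rw [firstKindConv, integral_smul_measure, integral_dirac' _ _ hf,
    ENNReal.toReal_ofReal hweight]

theorem isSymmQuasiCharacter_mul_iff (hpos : ∀ x, 0 < u x) (hinv : ∀ x, u x⁻¹ = u x) {ψ : G → ℂ}
    (hψ : StronglyMeasurable fun x => ψ x * u x) :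
    IsSymmQuasiCharacter (firstKindConv u) (fun x => ψ x * u x) ↔
      (∀ x y, ψ (x * y) = ψ x * ψ y) ∧ ∀ x, ψ x⁻¹ = conj (ψ x) := by
  have hne (x : G) : (u x : ℂ) ≠ 0 := Complex.ofReal_ne_zero.2 (hpos x).ne'
  have hmul (x y : G) :
      ψ x * u x * (ψ y * u y) = ∫ z, ψ z * u z ∂(firstKindConv u x y) ↔
        ψ (x * y) = ψ x * ψ y := by
    have hint : ∫ z, ψ z * u z ∂(firstKindConv u x y) = ψ (x * y) * (u x * u y) := by
      rw [integral_firstKindConv (fun z => (hpos z).le) hψ, Complex.real_smul]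
      push_cast
      field_simp [hne (x * y)]
    rw [hint, mul_mul_mul_comm, mul_left_inj' (mul_ne_zero (hne x) (hne y)), eq_comm]
  have hsymm (x : G) : ψ x⁻¹ * u x⁻¹ = conj (ψ x * u x) ↔ ψ x⁻¹ = conj (ψ x) := by
    rw [map_mul, Complex.conj_ofReal, hinv, mul_left_inj' (hne x)]
  exact ⟨fun h => ⟨fun x y => (hmul x y).1 (h.mul_eq x y), fun x => (hsymm x).1 (h.symm x)⟩,
    fun h => ⟨fun x y => (hmul x y).2 (h.1 x y), fun x => (hsymm x).2 (h.2 x)⟩⟩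

end FirstKind

theorem norm_eq_one_of_map_inv_eq_conj {H 𝕜 : Type*} [Group H] [RCLike 𝕜] {ψ : H →* 𝕜}
    (hψ : ∀ x, ψ x⁻¹ = conj (ψ x)) (x : H) : ‖ψ x‖ = 1 := by
  have hsq : ((‖ψ x‖ ^ 2 : ℝ) : 𝕜) = 1 := by
    rw [RCLike.ofReal_pow, ← RCLike.mul_conj, ← hψ, ← map_mul, mul_inv_cancel, map_one]
  exact (pow_eq_one_iff_of_nonneg (norm_nonneg _) two_ne_zero).1 (by exact_mod_cast hsq)

variable [TopologicalSpace G]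

theorem exists_pontryaginDual_coe_eq {ψ : G → ℂ} (hcont : Continuous ψ) (hne : ψ ≠ 0)
    (hmul : ∀ x y, ψ (x * y) = ψ x * ψ y) (hinv : ∀ x, ψ x⁻¹ = conj (ψ x)) :
    ∃ χ : PontryaginDual G, ∀ x, (χ x : ℂ) = ψ x := by
  obtain ⟨a, ha⟩ : ∃ a, ψ a ≠ 0 := Function.ne_iff.1 hne
  have hone : ψ 1 = 1 := by
    rw [← mul_eq_right₀ ha, ← hmul, one_mul]
  let Ψ : G →* ℂ := { toFun := ψ, map_one' := hone, map_mul' := hmul }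
  have hnorm (x : G) : ‖ψ x‖ = 1 := norm_eq_one_of_map_inv_eq_conj (ψ := Ψ) hinv x
  let χ : G →ₜ* Circle :=
    { toFun := fun x => ⟨ψ x, mem_sphere_zero_iff_norm.2 (hnorm x)⟩
      map_one' := Circle.ext hone
      map_mul' := fun x y => Circle.ext (hmul x y)
      continuous_toFun := hcont.subtype_mk _ }
  exact ⟨χ, fun _ => rfl⟩

section QuasiChar

variable {u : G → ℝ}

theorem quasiChar_injective (hu : ∀ x, u x ≠ 0) : Function.Injective (quasiChar u) :=
  fun _ _ h => PontryaginDual.ext fun x =>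
    Circle.ext <| mul_right_cancel₀ (Complex.ofReal_ne_zero.2 (hu x)) (congrFun h x)

variable [MeasurableSpace G] [OpensMeasurableSpace G]

theorem isSymmQuasiCharacter_quasiChar (hpos : ∀ x, 0 < u x) (hcont : Continuous u)
    (hinv : ∀ x, u x⁻¹ = u x) (χ : PontryaginDual G) :
    IsSymmQuasiCharacter (firstKindConv u) (quasiChar u χ) := by
  have hχ : Continuous (quasiChar u χ) :=
    (continuous_subtype_val.comp (map_continuous χ)).mul (Complex.continuous_ofReal.comp hcont)
  refine (isSymmQuasiCharacter_mul_iff hpos hinv hχ.stronglyMeasurable).2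
    ⟨fun x y => ?_, fun x => ?_⟩
  · rw [map_mul, Circle.coe_mul]
  · rw [map_inv, Circle.coe_inv_eq_conj]

theorem IsSymmQuasiCharacter.existsUnique_eq_quasiChar (hpos : ∀ x, 0 < u x) (hcont : Continuous u)
    (hinv : ∀ x, u x⁻¹ = u x) {φ : G → ℂ} (hφ : IsSymmQuasiCharacter (firstKindConv u) φ)
    (hφ_cont : Continuous φ) (hφ_ne : φ ≠ 0) :
    ∃! χ : PontryaginDual G, φ = quasiChar u χ := by
  have hne (x : G) : (u x : ℂ) ≠ 0 := Complex.ofReal_ne_zero.2 (hpos x).ne'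
  obtain ⟨ψ, hψ_cont, rfl⟩ : ∃ ψ : G → ℂ, Continuous ψ ∧ φ = fun x => ψ x * u x :=
    ⟨fun x => φ x / u x, hφ_cont.div (Complex.continuous_ofReal.comp hcont) hne,
      funext fun x => (div_mul_cancel₀ _ (hne x)).symm⟩
  have hψ_ne : ψ ≠ 0 := by
    rintro rfl
    exact hφ_ne (funext fun x => zero_mul _)
  obtain ⟨hmul, hsymm⟩ :=
    (isSymmQuasiCharacter_mul_iff hpos hinv hφ_cont.stronglyMeasurable).1 hφ
  obtain ⟨χ, hχ⟩ := exists_pontryaginDual_coe_eq hψ_cont hψ_ne hmul hsymm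
  have heq : (fun x => ψ x * u x) = quasiChar u χ := funext fun x => by rw [quasiChar, hχ]
  exact ⟨χ, heq, fun χ' h =>
    quasiChar_injective (fun x => (hpos x).ne') (h.symm.trans heq)⟩

end QuasiChar

section Evaluation

variable {A : Type*} [Monoid A] [TopologicalSpace A]

instance : ContinuousEvalConst (PontryaginDual A) A Circle :=
  inferInstanceAs (ContinuousEvalConst (A →ₜ* Circle) A Circle)

theorem coe_pontryaginDual_mul_apply (χ₁ χ₂ : PontryaginDual A) (x : A) :
    ((χ₁ * χ₂) x : ℂ) = χ₁ x * χ₂ x :=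
  rfl

theorem stronglyMeasurable_coe_pontryaginDual [MeasurableSpace (PontryaginDual A)]
    [OpensMeasurableSpace (PontryaginDual A)] (x : A) :
    StronglyMeasurable fun χ : PontryaginDual A => (χ x : ℂ) :=
  (continuous_subtype_val.comp (continuous_eval_const x)).stronglyMeasurable

end Evaluation

section Dual

variable [MeasurableSpace (PontryaginDual G)] (μ : Measure (PontryaginDual G))

theorem inverseFourier_inv (x : G) : inverseFourier μ x⁻¹ = conj (inverseFourier μ x) := by
  simp only [inverseFourier, map_inv, Circle.coe_inv_eq_conj]
  exact integral_conj

theorem integral_quasiChar (u : G → ℝ) (x : G) :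
    ∫ χ, quasiChar u χ x ∂μ = inverseFourier μ x * u x :=
  integral_mul_const (u x : ℂ) fun χ : PontryaginDual G => (χ x : ℂ)

theorem integrable_quasiChar [OpensMeasurableSpace (PontryaginDual G)] [IsFiniteMeasure μ]
    (u : G → ℝ) (x : G) : Integrable (fun χ : PontryaginDual G => quasiChar u χ x) μ :=
  (Integrable.of_bound (stronglyMeasurable_coe_pontryaginDual x).aestronglyMeasurable 1
    (.of_forall fun χ => (Circle.norm_coe (χ x)).le)).mul_const _

theorem inverseFourier_translateMeasure [BorelSpace (PontryaginDual G)] (ψ : PontryaginDual G)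
    (x : G) : inverseFourier (translateMeasure ψ μ) x = ψ x * inverseFourier μ x := by
  rw [inverseFourier, translateMeasure, integral_map (continuous_const_mul ψ).aemeasurable
      (stronglyMeasurable_coe_pontryaginDual x).aestronglyMeasurable]
  simp only [coe_pontryaginDual_mul_apply, integral_const_mul, inverseFourier]

theorem quasiChar_mul_quasiChar [BorelSpace (PontryaginDual G)] {u : G → ℝ} {x : G}
    (hμ : u x = inverseFourier μ x) (χ₁ χ₂ : PontryaginDual G) :
    quasiChar u χ₁ x * quasiChar u χ₂ x = ∫ χ, quasiChar u χ x ∂(secondKindConv μ χ₁ χ₂) := by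
  rw [integral_quasiChar, secondKindConv, inverseFourier_translateMeasure, ← hμ,
    coe_pontryaginDual_mul_apply, quasiChar, quasiChar]
  ring

end Dual

end GhostSpace

open GhostSpace MeasureTheory in
theorem proposition4p1_general {G : Type*} [CommGroup G] [TopologicalSpace G] [MeasurableSpace G]
    [OpensMeasurableSpace G] [MeasurableSpace (PontryaginDual G)] [BorelSpace (PontryaginDual G)]
    {u : G → ℝ} (hpos : ∀ x, 0 < u x) (hcont : Continuous u)
    (μ : Measure (PontryaginDual G)) [IsFiniteMeasure μ] (hμ : ∀ x, u x = inverseFourier μ x) :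
    (∀ χ : PontryaginDual G, IsSymmQuasiCharacter (firstKindConv u) (quasiChar u χ)) ∧
    (∀ φ : G → ℂ, Continuous φ → φ ≠ 0 → IsSymmQuasiCharacter (firstKindConv u) φ →
      ∃! χ : PontryaginDual G, φ = quasiChar u χ) ∧
    (∀ (χ₁ χ₂ : PontryaginDual G) (x : G),
      Integrable (fun χ : PontryaginDual G => quasiChar u χ x) (secondKindConv μ χ₁ χ₂) ∧
      quasiChar u χ₁ x * quasiChar u χ₂ x =
        ∫ χ, quasiChar u χ x ∂(secondKindConv μ χ₁ χ₂)) := by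
  have hinv (x : G) : u x⁻¹ = u x := Complex.ofReal_injective <| by
    rw [hμ, inverseFourier_inv, ← hμ, Complex.conj_ofReal]
  have hfinite (χ₁ χ₂ : PontryaginDual G) : IsFiniteMeasure (secondKindConv μ χ₁ χ₂) :=
    Measure.isFiniteMeasure_map _ _
  exact ⟨isSymmQuasiCharacter_quasiChar hpos hcont hinv,
    fun _ hφ_cont hφ_ne hφ => hφ.existsUnique_eq_quasiChar hpos hcont hinv hφ_cont hφ_ne,
    fun χ₁ χ₂ x => ⟨integrable_quasiChar _ u x, quasiChar_mul_quasiChar μ (hμ x) χ₁ χ₂⟩⟩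

theorem proposition4p1 {G : Type*} [CommGroup G] [TopologicalSpace G] [IsTopologicalGroup G]
    [LocallyCompactSpace G] [MeasurableSpace G] [BorelSpace G]
    [MeasurableSpace (PontryaginDual G)] [BorelSpace (PontryaginDual G)]
    (u : G → ℝ) (hu : GhostSpace.IsGhostFunction u)
    (uHat : MeasureTheory.Measure (PontryaginDual G))
    (huHat : GhostSpace.IsFourierTransform u uHat) :
    (∀ χ : PontryaginDual G, GhostSpace.IsSymmQuasiCharacter (GhostSpace.firstKindConv u)
      (GhostSpace.quasiChar u χ)) ∧
    (∀ φ : G → ℂ, Continuous φ → φ ≠ 0 →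
      GhostSpace.IsSymmQuasiCharacter (GhostSpace.firstKindConv u) φ →
        ∃! χ : PontryaginDual G, φ = GhostSpace.quasiChar u χ) ∧
    (∀ (χ₁ χ₂ : PontryaginDual G) (x : G),
      MeasureTheory.Integrable (fun χ : PontryaginDual G => GhostSpace.quasiChar u χ x)
        (GhostSpace.secondKindConv uHat χ₁ χ₂) ∧
      GhostSpace.quasiChar u χ₁ x * GhostSpace.quasiChar u χ₂ x =
        ∫ χ, GhostSpace.quasiChar u χ x ∂(GhostSpace.secondKindConv uHat χ₁ χ₂)) := by
  have := huHat.finite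
  exact proposition4p1_general hu.pos hu.continuous uHat huHat.inverseFourier_eq
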